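/- All graphs are simple and finite. For a connected graph $G$ with $|G|$ vertices, a connected set of $G$ is a non-empty set $S\subseteq V(G)$ such that the induced subgraph $G[S]$ is connected. Let $\mathcal{C}(G)$ be the family of connected sets of $G$, let $N(G)=|\mathcal{C}(G)|$, let $A(G)=\frac{1}{N(G)}\sum_{S\in\mathcal{C}(G)}|S|$ be the average order of the connected sets, and let $D(G)=A(G)/|G|$ be the connected set density of $G$. Let $v_2(G)$ be the number of vertices of degree $2$ in $G$. Theorem. If $(G_n)_{n\in\mathbb{N}}$ is a sequence of connected graphs, each with at least two vertices, such that $D(G_n)\to 1$ as $n\to\infty$, then $v_2(G_n)/|G_n|\to 1$ as $n\to\infty$. -/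

import Mathlib

open Filter Topology

namespace SimpleGraph

open Classical in
/-- The family of connected sets of a finite graph `G`: the non-empty vertex sets `S` whose
induced subgraph `G[S]` is connected (`SimpleGraph.Connected` includes non-emptiness). -/
noncomputable def connectedSets {V : Type*} [Fintype V] (G : SimpleGraph V) :
    Finset (Finset V) :=
  Finset.univ.filter fun S => (G.induce (S : Set V)).Connected

/-- `N(G)`, the number of connected sets of `G`. -/
noncomputable def numConnectedSets {V : Type*} [Fintype V] (G : SimpleGraph V) : ℕ :=
  G.connectedSets.card

/-- `A(G)`, the average order of the connected sets of `G`. -/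
noncomputable def avgConnectedSetOrder {V : Type*} [Fintype V] (G : SimpleGraph V) : ℝ :=
  (∑ S ∈ G.connectedSets, (S.card : ℝ)) / (G.numConnectedSets : ℝ)

/-- `D(G) = A(G) / |G|`, the connected set density of `G`. -/
noncomputable def connectedSetDensity {V : Type*} [Fintype V] (G : SimpleGraph V) : ℝ :=
  G.avgConnectedSetOrder / (Fintype.card V : ℝ)

open Classical in
/-- `v₂(G)`, the number of vertices of degree `2` in `G`. -/
noncomputable def numDegreeTwo {V : Type*} [Fintype V] (G : SimpleGraph V) : ℕ :=
  (Finset.univ.filter fun v : V => G.degree v = 2).card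

end SimpleGraph

/-! Many vertices of degree other than 2 force a spanning tree with linearly many leaves: a forest
of large excess extends to a spanning tree, whose leaves number its excess plus 2. Deleting any
proper subset of the `l` leaves keeps connectedness, so `N ≥ 2^l - 1`. Conversely, the mean
complement of a connected set has size `(1 - D) n`, and convexity of `exp` gives `log N ≤ n (e^{-s}
+ s (1 - D))` for every `s`. When `D → 1` this is `o(n)`, hence so are `l` and the number of
vertices of degree other than 2. -/

open Classical in
/-- The excess of a graph: the sum over all vertices of the degree above two. -/
noncomputable def SimpleGraph.excess {V : Type*} [Fintype V] (F : SimpleGraph V) : ℕ :=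
  ∑ v, (F.degree v - 2)

open Classical in
/-- The finset of non-isolated vertices of a graph. -/
noncomputable def SimpleGraph.covered {V : Type*} [Fintype V] (F : SimpleGraph V) : Finset V :=
  Finset.univ.filter fun v => F.degree v ≠ 0

namespace SimpleGraph

variable {V : Type*} [Fintype V]

/-! ### Forests with large excess -/

open Classical in
theorem degree_of_eq_sup_edge {F F' : SimpleGraph V} {v w : V} (hF' : F' = F ⊔ edge v w)
    (hvw : v ≠ w) (hF : ¬ F.Adj v w) (x : V) :
    F'.degree x = F.degree x + if x = v ∨ x = w then 1 else 0 := by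
  have key : ∀ a b : V, F' = F ⊔ edge a b → a ≠ b → ¬ F.Adj a b →
      F'.degree a = F.degree a + 1 := by
    intro a b h hab hadj
    have hn : F'.neighborFinset a = insert b (F.neighborFinset a) := by
      ext y
      simp only [h, mem_neighborFinset, sup_adj, edge_adj, Finset.mem_insert]
      grind
    rw [← card_neighborFinset_eq_degree, hn, Finset.card_insert_of_notMem (by simpa),
      card_neighborFinset_eq_degree]
  by_cases h1 : x = v
  · rw [h1, key v w hF' hvw hF, if_pos (Or.inl rfl)]
  by_cases h2 : x = w
  · rw [h2, key w v (by rw [hF', edge_comm]) hvw.symm (fun h => hF h.symm), if_pos (Or.inr rfl)]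
  · rw [if_neg (by tauto), add_zero, ← card_neighborFinset_eq_degree,
      ← card_neighborFinset_eq_degree]
    congr 1
    ext y
    simp only [hF', mem_neighborFinset, sup_adj, edge_adj]
    grind

-- Each `w` is isolated when its edge to `v` is added, so no cycle can close.
open Classical in
theorem exists_isAcyclic_star_extension {G F : SimpleGraph V} (hFG : F ≤ G) (hF : F.IsAcyclic)
    {v : V} (W : Finset V) (hW : ∀ w ∈ W, F.degree w = 0 ∧ G.Adj v w) :
    ∃ F' ≤ G, F'.IsAcyclic ∧ ∀ x, F'.degree x =
      if x = v then F.degree v + W.card else if x ∈ W then 1 else F.degree x := by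
  induction W using Finset.induction_on with
  | empty => exact ⟨F, hFG, hF, fun x => by rcases eq_or_ne x v with rfl | h <;> simp [*]⟩
  | insert w W hw ih =>
    obtain ⟨F', hle, hac, hdeg⟩ := ih fun x hx => hW x (Finset.mem_insert_of_mem hx)
    obtain ⟨hw0, hvw⟩ := hW w (Finset.mem_insert_self _ _)
    have hne : v ≠ w := hvw.ne
    have hw' : F'.degree w = 0 := by rw [hdeg, if_neg hne.symm, if_neg hw, hw0]
    have hnr : ¬ F'.Reachable v w := not_reachable_of_right_degree_zero hne hw'
    refine ⟨F' ⊔ edge v w, sup_le hle ((edge_le_iff G).2 (Or.inr hvw)),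
      hac.sup_edge_of_not_reachable hnr, fun x => ?_⟩
    rw [degree_of_eq_sup_edge rfl hne (fun h => hnr h.reachable), hdeg x]
    by_cases hxv : x = v
    · simp [hxv, Finset.card_insert_of_notMem hw, add_assoc]
    · by_cases hxw : x = w
      · subst hxw
        simp [hxv, hw, hw0]
      · simp [hxv, hxw]

open Classical in
theorem mem_covered {F : SimpleGraph V} {v : V} : v ∈ F.covered ↔ F.degree v ≠ 0 := by
  simp [covered]

-- Only `v` changes its contribution to the excess, since the new leaves contribute 0. The additive
-- form avoids truncated subtraction of excesses.
open Classical in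
theorem exists_isAcyclic_excess_covered {G F : SimpleGraph V} (hFG : F ≤ G) (hF : F.IsAcyclic)
    {v : V} (W : Finset V) (hW : ∀ w ∈ W, w ∉ F.covered ∧ G.Adj v w) :
    ∃ F' ≤ G, F'.IsAcyclic ∧
      F'.excess + (F.degree v - 2) = F.excess + (F.degree v + W.card - 2) ∧
      F'.covered ⊆ insert v (W ∪ F.covered) ∧ (W.Nonempty → v ∈ F'.covered ∧ W ⊆ F'.covered) := by
  simp only [mem_covered, not_not] at hW
  obtain ⟨F', hle, hac, hdeg⟩ := exists_isAcyclic_star_extension hFG hF W hW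
  have hvW : v ∉ W := fun h => (hW v h).2.ne rfl
  refine ⟨F', hle, hac, ?_, ?_, ?_⟩
  · have h1 := Finset.sum_erase_add Finset.univ (fun x => F.degree x - 2) (Finset.mem_univ v)
    have h2 := Finset.sum_erase_add Finset.univ (fun x => F'.degree x - 2) (Finset.mem_univ v)
    have h3 : ∑ x ∈ Finset.univ.erase v, (F'.degree x - 2) =
        ∑ x ∈ Finset.univ.erase v, (F.degree x - 2) := by
      refine Finset.sum_congr rfl fun x hx => ?_
      rw [hdeg x, if_neg (Finset.ne_of_mem_erase hx)]
      split_ifs with hxW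
      · rw [(hW x hxW).1]
      · rfl
    have h4 : F'.degree v = F.degree v + W.card := by rw [hdeg, if_pos rfl]
    simp only [excess]
    rw [← h1, ← h2, h3, h4]
    omega
  · intro x hx
    rw [mem_covered, hdeg x] at hx
    simp only [Finset.mem_insert, Finset.mem_union, mem_covered]
    grind
  · intro hne
    refine ⟨?_, fun x hx => ?_⟩
    · rw [mem_covered, hdeg, if_pos rfl]
      have := hne.card_pos
      omega
    · rw [mem_covered, hdeg, if_neg (fun h : x = v => hvW (h ▸ hx)), if_pos hx]
      simp

open Classical in
/-- Every graph contains a forest whose excess is at least one eighth of the number of vertices of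
degree at least three. -/
theorem exists_isAcyclic_card_le_excess (G : SimpleGraph V) :
    ∃ F ≤ G, F.IsAcyclic ∧ (Finset.univ.filter fun v => 3 ≤ G.degree v).card ≤ 8 * F.excess := by
  -- The ratio 4 is that of a claw: four covered vertices, excess one. Each enlargement below covers
  -- at most four more vertices and gains at least one, so maximality forbids it.
  obtain ⟨F, ⟨hFG, hF, hcov⟩, hmax'⟩ := Set.Finite.exists_maximalFor excess
    {F : SimpleGraph V | F ≤ G ∧ F.IsAcyclic ∧ F.covered.card ≤ 4 * F.excess} (Set.toFinite _)
    ⟨⊥, bot_le, isAcyclic_bot, by simp [covered]⟩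
  have hmax : ∀ F' ≤ G, F'.IsAcyclic → F'.covered.card ≤ 4 * F'.excess →
      F'.excess ≤ F.excess := by
    intro F' h1 h2 h3
    by_contra! h
    exact absurd (hmax' ⟨h1, h2, h3⟩ h.le) (not_le.2 h)
  set U : V → Finset V := fun v => (G.neighborFinset v).filter fun w => w ∉ F.covered with hU
  have hUmem : ∀ v w, w ∈ U v ↔ G.Adj v w ∧ w ∉ F.covered := by simp [hU]
  have hB : ∀ v ∈ F.covered, (U v).card ≤ 1 := by
    intro v hv
    by_contra! h
    obtain ⟨W, hWU, hW2⟩ := Finset.exists_subset_card_eq h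
    obtain ⟨F', h1, h2, h3, h4, -⟩ := exists_isAcyclic_excess_covered hFG hF W
      fun w hw => ((hUmem v w).1 (hWU hw)).symm
    have h5 := mem_covered.1 hv
    have h6 := Finset.card_le_card h4
    rw [Finset.insert_eq_of_mem (Finset.mem_union_right _ hv)] at h6
    have h7 := Finset.card_union_le W F.covered
    have h8 := hmax F' h1 h2 (by omega)
    omega
  have hA : ∀ v, v ∉ F.covered → (U v).card ≤ 2 := by
    intro v hv
    by_contra! h
    obtain ⟨W, hWU, hW2⟩ := Finset.exists_subset_card_eq (show 3 ≤ (U v).card from h)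
    obtain ⟨F', h1, h2, h3, h4, -⟩ := exists_isAcyclic_excess_covered hFG hF W
      fun w hw => ((hUmem v w).1 (hWU hw)).symm
    have h5 : F.degree v = 0 := by simpa [mem_covered] using hv
    have h6 := Finset.card_le_card h4
    have h7 := Finset.card_union_le W F.covered
    have h8 := Finset.card_insert_le v (W ∪ F.covered)
    have h9 := hmax F' h1 h2 (by omega)
    omega
  have hC : ∀ u ∈ F.covered, ∀ v ∈ U u, (U v).card ≤ 1 := by
    intro u hu v hv
    by_contra! h
    obtain ⟨hadj, hvc⟩ := (hUmem u v).1 hv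
    obtain ⟨W, hWU, hW2⟩ := Finset.exists_subset_card_eq h
    obtain ⟨F₁, h1, h2, h3, h4, h5⟩ := exists_isAcyclic_excess_covered hFG hF (v := u) {v}
      (by simpa using ⟨hvc, hadj⟩)
    rw [Finset.insert_eq_of_mem (Finset.mem_union_right _ hu)] at h4
    have hv1 : v ∈ F₁.covered := (h5 (by simp)).2 (by simp)
    obtain ⟨F', h1', h2', h3', h4', -⟩ := exists_isAcyclic_excess_covered h1 h2 (v := v) W
      fun w hw => by
        obtain ⟨ha, hb⟩ := (hUmem v w).1 (hWU hw)
        refine ⟨fun hc => ?_, ha⟩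
        have := h4 hc
        simp only [Finset.mem_union, Finset.mem_singleton, hb, or_false] at this
        exact ha.ne this.symm
    rw [Finset.insert_eq_of_mem (Finset.mem_union_right _ hv1)] at h4'
    have h6 := mem_covered.1 hv1
    have h7 := (Finset.card_le_card h4).trans (Finset.card_union_le _ _)
    have h8 := (Finset.card_le_card h4').trans (Finset.card_union_le _ _)
    simp only [Finset.card_singleton] at h7 h3
    have h9 := hmax F' h1' h2' (by omega)
    omega
  refine ⟨F, hFG, hF, ?_⟩
  -- A vertex of degree at least 3 outside both sets would have only uncovered neighbours, against
  -- `hA`. By `hB` the second set is no larger than `F.covered`, whence 8 = 2 · 4.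
  have hsub : (Finset.univ.filter fun v => 3 ≤ G.degree v) ⊆ F.covered ∪ F.covered.biUnion U := by
    intro v hv
    simp only [Finset.mem_filter, Finset.mem_univ, true_and] at hv
    rw [Finset.mem_union, Finset.mem_biUnion]
    by_contra! hcon
    obtain ⟨hvc, hnu⟩ := hcon
    have hUv : U v = G.neighborFinset v := by
      refine Finset.filter_true_of_mem fun w hw hwc => ?_
      exact hnu w hwc ((hUmem w v).2 ⟨((mem_neighborFinset _ _ _).1 hw).symm, hvc⟩)
    have := hA v hvc
    rw [hUv, card_neighborFinset_eq_degree] at this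
    omega
  have h1 := (Finset.card_le_card hsub).trans (Finset.card_union_le _ _)
  have h2 := Finset.card_biUnion_le_card_mul F.covered U 1 hB
  omega

/-! ### Spanning trees with many leaves -/

open Classical in
theorem excess_mono {F T : SimpleGraph V} (h : F ≤ T) : F.excess ≤ T.excess :=
  Finset.sum_le_sum fun _ _ => Nat.sub_le_sub_right (degree_le_of_le h) 2

-- Compare the degree sum `2 (n - 1)` with the sum of the pointwise identity `h3`.
open Classical in
theorem IsTree.card_leaves [Nontrivial V] {T : SimpleGraph V} (hT : T.IsTree) :
    (Finset.univ.filter fun v => T.degree v = 1).card = T.excess + 2 := by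
  have h1 := T.sum_degrees_eq_twice_card_edges
  have h2 := hT.card_edgeFinset
  have h3 : ∀ v, T.degree v + (if T.degree v = 1 then 1 else 0) = (T.degree v - 2) + 2 := by
    intro v
    have := hT.connected.preconnected.degree_pos_of_nontrivial v
    split_ifs <;> omega
  have h4 := Finset.sum_congr (rfl : (Finset.univ : Finset V) = _) fun w _ => h3 w
  rw [Finset.sum_add_distrib, Finset.sum_add_distrib, ← Finset.card_filter] at h4
  simp only [Finset.sum_const, Finset.card_univ, smul_eq_mul] at h4
  simp only [excess]
  omega

open Classical in
/-- A connected graph has a spanning tree whose number of leaves is at least one ninth of the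
number of vertices of degree different from two. -/
theorem Connected.exists_isTree_card_leaves [Nontrivial V] {G : SimpleGraph V}
    (hG : G.Connected) :
    ∃ T ≤ G, T.IsTree ∧ (Finset.univ.filter fun v => G.degree v ≠ 2).card ≤
      9 * (Finset.univ.filter fun v => T.degree v = 1).card := by
  obtain ⟨F, hFG, hF, hle⟩ := G.exists_isAcyclic_card_le_excess
  obtain ⟨T, hFT, hTG, hT⟩ := hG.exists_isTree_le_of_le_of_isAcyclic hFG hF
  refine ⟨T, hTG, hT, ?_⟩
  have hsub : (Finset.univ.filter fun v => G.degree v ≠ 2) ⊆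
      (Finset.univ.filter fun v => T.degree v = 1) ∪
        (Finset.univ.filter fun v => 3 ≤ G.degree v) := by
    intro v hv
    simp only [Finset.mem_filter, Finset.mem_univ, true_and, Finset.mem_union] at hv ⊢
    have h1 := hT.connected.preconnected.degree_pos_of_nontrivial v
    have h2 : T.degree v ≤ G.degree v := degree_le_of_le hTG
    omega
  have h1 := (Finset.card_le_card hsub).trans (Finset.card_union_le _ _)
  have h2 := hT.card_leaves
  have h3 := excess_mono hFT
  omega

open Classical in
theorem Connected.two_pow_card_leaves_le {G T : SimpleGraph V} (hTG : T ≤ G)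
    (hT : T.Connected) :
    2 ^ (Finset.univ.filter fun v => T.degree v = 1).card ≤ G.numConnectedSets + 1 := by
  set L := Finset.univ.filter fun v => T.degree v = 1 with hL
  -- The empty set occurs when every vertex is a leaf, as in a single edge.
  have hsub : L.powerset.image (fun X => Xᶜ) ⊆ insert ∅ G.connectedSets := by
    intro S hS
    obtain ⟨X, hX, rfl⟩ := Finset.mem_image.1 hS
    rw [Finset.mem_powerset] at hX
    rw [Finset.mem_insert, connectedSets, Finset.mem_filter]
    rcases (Xᶜ).eq_empty_or_nonempty with h | h
    · exact Or.inl h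
    · refine Or.inr ⟨Finset.mem_univ _, ?_⟩
      have hpre : (T.induce ((Xᶜ : Finset V) : Set V)).Preconnected := by
        refine hT.preconnected.induce_of_degree_eq_one fun v hv => ?_
        have hvX : v ∈ X := by simpa using hv
        have h1 := (Finset.mem_filter.1 (hX hvX)).2
        rw [← card_neighborFinset_eq_degree] at h1
        intro a ha b hb
        exact Finset.card_le_one.1 h1.le a (by simpa using ha) b (by simpa using hb)
      have : Nonempty ((Xᶜ : Finset V) : Set V) := h.to_subtype
      exact (Connected.mk hpre).mono (fun a b hab => hTG hab)
  have h1 := Finset.card_le_card hsub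
  rw [Finset.card_image_of_injective _ compl_injective, Finset.card_powerset] at h1
  exact h1.trans (Finset.card_insert_le _ _)

/-! ### Density bounds the number of connected sets -/

open Classical in
theorem sum_pow_card_compl_connectedSets_le (G : SimpleGraph V) {x : ℝ} (hx : 0 ≤ x) :
    ∑ S ∈ G.connectedSets, x ^ (Sᶜ : Finset V).card ≤ (1 + x) ^ Fintype.card V := by
  calc ∑ S ∈ G.connectedSets, x ^ (Sᶜ : Finset V).card
      ≤ ∑ S : Finset V, x ^ (Sᶜ : Finset V).card :=
        Finset.sum_le_sum_of_subset_of_nonneg (Finset.subset_univ _) fun _ _ _ => by positivity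
    _ = ∑ S : Finset V, 1 ^ S.card * x ^ (Fintype.card V - S.card) := by
        simp [Finset.card_compl]
    _ = (1 + x) ^ Fintype.card V := Fintype.sum_pow_mul_eq_add_pow V 1 x

theorem numConnectedSets_pos [Nonempty V] (G : SimpleGraph V) : 0 < G.numConnectedSets := by
  classical
  obtain ⟨v⟩ := ‹Nonempty V›
  refine Finset.card_pos.2 ⟨{v}, ?_⟩
  rw [connectedSets, Finset.mem_filter]
  have : Subsingleton (({v} : Finset V) : Set V) := by simp
  have : Nonempty (({v} : Finset V) : Set V) := by simp
  exact ⟨Finset.mem_univ _, .of_subsingleton⟩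

/-- The number of connected sets is bounded in terms of the density, by convexity. -/
theorem numConnectedSets_mul_exp_le [Nonempty V] (G : SimpleGraph V) (s : ℝ) :
    (G.numConnectedSets : ℝ) * Real.exp (-s * ((1 - G.connectedSetDensity) * Fintype.card V)) ≤
      (1 + Real.exp (-s)) ^ Fintype.card V := by
  classical
  refine le_trans ?_ (G.sum_pow_card_compl_connectedSets_le (Real.exp_pos (-s)).le)
  have hN : (G.numConnectedSets : ℝ) ≠ 0 := by exact_mod_cast G.numConnectedSets_pos.ne'
  have hn : (Fintype.card V : ℝ) ≠ 0 := by exact_mod_cast Fintype.card_ne_zero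
  set a : ℝ := (1 - G.connectedSetDensity) * Fintype.card V with ha
  have hcompl : ∀ S : Finset V, ((Sᶜ : Finset V).card : ℝ) = Fintype.card V - S.card := by
    intro S
    rw [Finset.card_compl, Nat.cast_sub (Finset.card_le_univ S)]
  have hsum : ∑ S ∈ G.connectedSets, ((Sᶜ : Finset V).card : ℝ) = G.numConnectedSets * a := by
    simp only [hcompl, Finset.sum_sub_distrib, Finset.sum_const, nsmul_eq_mul]
    rw [ha, connectedSetDensity, avgConnectedSetOrder]
    change (G.numConnectedSets : ℝ) * _ - _ = _
    field_simp
  -- Jensen via the tangent to `exp` at `-s * a`: as `a` is the mean complement size, the linear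
  -- terms cancel.
  calc (G.numConnectedSets : ℝ) * Real.exp (-s * a)
      = ∑ S ∈ G.connectedSets,
          Real.exp (-s * a) * (-s * ((Sᶜ : Finset V).card - a) + 1) := by
        rw [← Finset.mul_sum, Finset.sum_add_distrib, ← Finset.mul_sum, Finset.sum_sub_distrib,
          hsum]
        simp only [Finset.sum_const, nsmul_eq_mul, mul_one]
        change _ = Real.exp (-s * a) * (-s * (G.numConnectedSets * a - G.numConnectedSets * a) +
          G.numConnectedSets)
        ring
    _ ≤ ∑ S ∈ G.connectedSets, Real.exp (-s) ^ (Sᶜ : Finset V).card := by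
        refine Finset.sum_le_sum fun S _ => ?_
        calc _ ≤ Real.exp (-s * a) * Real.exp (-s * ((Sᶜ : Finset V).card - a)) :=
              mul_le_mul_of_nonneg_left (Real.add_one_le_exp _) (Real.exp_pos _).le
          _ = Real.exp (-s) ^ (Sᶜ : Finset V).card := by
              rw [← Real.exp_add, ← Real.exp_nat_mul]
              ring_nf

/-- The fraction of vertices of degree different from two is bounded in terms of the density. -/
theorem Connected.one_sub_numDegreeTwo_div_le [Nontrivial V] {G : SimpleGraph V}
    (hG : G.Connected) (s : ℝ) :
    (1 - (G.numDegreeTwo : ℝ) / Fintype.card V) * Real.log 2 ≤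
      18 * (Real.exp (-s) + s * (1 - G.connectedSetDensity)) := by
  classical
  obtain ⟨T, hTG, hT, hle⟩ := hG.exists_isTree_card_leaves
  have h2 := hT.connected.two_pow_card_leaves_le hTG
  have hL := hT.card_leaves
  set l := (Finset.univ.filter fun v => T.degree v = 1).card
  have hNpos : (0 : ℝ) < G.numConnectedSets := by exact_mod_cast G.numConnectedSets_pos
  have hn : (0 : ℝ) < Fintype.card V := by exact_mod_cast Fintype.card_pos
  -- Two leaves give `N ≥ 3`, so `N + 1 ≤ N ^ 2`; the square doubles the constant 9 to 18.
  have hpow : (2 : ℝ) ^ l ≤ G.numConnectedSets ^ 2 := by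
    have h3 : 3 ≤ G.numConnectedSets := by
      have : 2 ^ 2 ≤ 2 ^ l := Nat.pow_le_pow_right (by norm_num) (by omega)
      omega
    exact_mod_cast (by nlinarith : 2 ^ l ≤ G.numConnectedSets ^ 2)
  have hlog1 : l * Real.log 2 ≤ 2 * Real.log G.numConnectedSets := by
    have := Real.log_le_log (by positivity) hpow
    rwa [Real.log_pow, Real.log_pow, Nat.cast_ofNat] at this
  have hlog2 : Real.log G.numConnectedSets ≤
      Fintype.card V * (Real.exp (-s) + s * (1 - G.connectedSetDensity)) := by
    have := Real.log_le_log (by positivity) (G.numConnectedSets_mul_exp_le s)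
    rw [Real.log_mul hNpos.ne' (Real.exp_pos _).ne', Real.log_exp, Real.log_pow] at this
    have h4 : Real.log (1 + Real.exp (-s)) ≤ Real.exp (-s) := by
      have := Real.log_le_sub_one_of_pos (by positivity : 0 < 1 + Real.exp (-s))
      linarith
    have h5 := mul_le_mul_of_nonneg_left h4 hn.le
    linarith
  have hcount : (Fintype.card V : ℝ) - G.numDegreeTwo ≤ 9 * l := by
    have := Finset.card_filter_add_card_filter_not (s := (Finset.univ : Finset V))
      (fun v => G.degree v = 2)
    have h6 : Fintype.card V ≤ G.numDegreeTwo + 9 * l := by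
      rw [← Finset.card_univ, ← this, numDegreeTwo]
      exact Nat.add_le_add_left hle _
    have : (Fintype.card V : ℝ) ≤ G.numDegreeTwo + 9 * l := by exact_mod_cast h6
    linarith
  have h7 := mul_le_mul_of_nonneg_right hcount (Real.log_nonneg one_le_two)
  rw [one_sub_div hn.ne', div_mul_eq_mul_div, div_le_iff₀ hn]
  linarith

theorem numDegreeTwo_le_card (G : SimpleGraph V) : G.numDegreeTwo ≤ Fintype.card V :=
  Finset.card_le_univ _

end SimpleGraph

theorem mainTheorem5 (V : ℕ → Type*) [∀ n, Fintype (V n)] [∀ n, Nontrivial (V n)]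
    (G : ∀ n, SimpleGraph (V n)) (hconn : ∀ n, (G n).Connected)
    (hD : Tendsto (fun n => (G n).connectedSetDensity) atTop (𝓝 1)) :
    Tendsto (fun n => ((G n).numDegreeTwo : ℝ) / (Fintype.card (V n) : ℝ)) atTop (𝓝 1) := by
  have hlog : 0 < Real.log 2 := Real.log_pos one_lt_two
  rw [tendsto_order]
  refine ⟨fun a ha => ?_, fun a ha => Eventually.of_forall fun n => ?_⟩
  · have hε : 0 < (1 - a) * Real.log 2 / 18 := by
      have := sub_pos.2 ha
      positivity
    -- Fix `s` first to make `e^{-s}` small; then `s (1 - D)` tends to 0.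
    obtain ⟨s, hs⟩ := ((Real.tendsto_exp_neg_atTop_nhds_zero).eventually_lt_const hε).exists
    have hlim : Tendsto (fun n => Real.exp (-s) + s * (1 - (G n).connectedSetDensity)) atTop
        (𝓝 (Real.exp (-s))) := by
      simpa using ((hD.const_sub 1).const_mul s).const_add (Real.exp (-s))
    filter_upwards [hlim.eventually_lt_const hs] with n hn
    have h1 := (hconn n).one_sub_numDegreeTwo_div_le s
    have h2 : (1 - ((G n).numDegreeTwo : ℝ) / Fintype.card (V n)) * Real.log 2 <
        (1 - a) * Real.log 2 := by linarith
    have h3 := lt_of_mul_lt_mul_right h2 hlog.le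
    linarith
  · refine lt_of_le_of_lt (div_le_one_of_le₀ ?_ (Nat.cast_nonneg _)) ha
    exact_mod_cast (G n).numDegreeTwo_le_card
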